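/- Let $\{0,1\}^*$ be the set of binary strings. For a partial function $D$ from $\{0,1\}^*\times\mathbb N$ to $\{0,1\}^*$ put $C_D(x\,|\,n)=\min\{|p| : D(p,n)=x\}$, and for a partial function $E$ from $\{0,1\}^*$ to $\{0,1\}^*$ put $C_E(x)=\min\{|p| : E(p)=x\}$ (with $\min\emptyset=\infty$). Let $\mathbf 0'$ be the halting set, i.e. the universal enumerable set $\{\langle e,m\rangle : \text{program } e \text{ halts on input } m\}$. Let $D$ be an optimal conditional description method, i.e. $D$ is partial computable and for every partial computable $D'$ from $\{0,1\}^*\times\mathbb N$ to $\{0,1\}^*$ there is a constant $c$ with $C_D(x\,|\,n)\le C_{D'}(x\,|\,n)+c$ for all $x,n$; write $C(x\,|\,n)=C_D(x\,|\,n)$ (plain conditional Kolmogorov complexity). Let $E$ be an optimal description method relative to $\mathbf 0'$, i.e. $E$ is partial computable with oracle $\mathbf 0'$ and for every $E'$ from $\{0,1\}^*$ to $\{0,1\}^*$ that is partial computable with oracle $\mathbf 0'$ there is a constant $c$ with $C_E(x)\le C_{E'}(x)+c$ for all $x$; write $C^{\mathbf 0'}(x)=C_E(x)$ (plain Kolmogorov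 complexity relative to $\mathbf 0'$). Then $$\limsup_{n\to\infty} C(x\,|\,n)=C^{\mathbf 0'}(x)+O(1),$$ that is, there is a constant $c$ (depending only on $D$ and $E$) such that for every binary string $x$ $$\limsup_{n\to\infty} C(x\,|\,n)\le C^{\mathbf 0'}(x)+c\quad\text{and}\quad C^{\mathbf 0'}(x)\le\limsup_{n\to\infty} C(x\,|\,n)+c .$$ -/

import Mathlib

namespace KolmogorovLimit

/-- Binary strings. -/
abbrev BinStr := List Bool

/-- The halting set `0'`: the universal enumerable set of all pairs `⟨e, m⟩` such that the program
with number `e` halts on input `m`. -/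
def haltingSet : Set ℕ :=
  {k | (Nat.Partrec.Code.eval (Nat.Partrec.Code.ofNatCode k.unpair.1) k.unpair.2).Dom}

open Classical in
/-- The (total) characteristic function of the halting set, used as an oracle. -/
noncomputable def haltingOracle : ℕ →. ℕ :=
  fun k => Part.some (if k ∈ haltingSet then 1 else 0)

/-- `descComplexity D x`: the length of a shortest description `p` of `x` under the description
method `D`; it is `⊤` if `x` has no description. -/
noncomputable def descComplexity (D : BinStr →. BinStr) (x : BinStr) : ℕ∞ :=
  ⨅ p ∈ {p : BinStr | x ∈ D p}, (p.length : ℕ∞)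

/-- `condComplexity D x n`: the length of a shortest description `p` of `x` under the conditional
description method `D` when the condition `n` is given. -/
noncomputable def condComplexity (D : BinStr → ℕ →. BinStr) (x : BinStr) (n : ℕ) : ℕ∞ :=
  descComplexity (fun p => D p n) x

/-- `D` is an optimal conditional description method: it is partial computable, and it is at least
as good as every other such method up to an additive constant. For such `D` the function
`condComplexity D` is the plain conditional complexity `C(x|n)`. -/
structure IsOptimalCond (D : BinStr → ℕ →. BinStr) : Prop where
  partrec : Partrec₂ D
  optimal : ∀ D' : BinStr → ℕ →. BinStr, Partrec₂ D' →
    ∃ c : ℕ, ∀ (x : BinStr) (n : ℕ), condComplexity D x n ≤ condComplexity D' x n + c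

/-- `D` is an optimal description method relative to the oracle set `O`: it is partial computable
with oracle `O`, and it is at least as good as every other such method up to an additive constant.
For such `D` the function `descComplexity D` is the relativized plain complexity `C^O(x)`. -/
structure IsOptimalIn (O : Set (ℕ →. ℕ)) (D : BinStr →. BinStr) : Prop where
  recursiveIn : RecursiveIn O D
  optimal : ∀ D' : BinStr →. BinStr, RecursiveIn O D' →
    ∃ c : ℕ, ∀ x : BinStr, descComplexity D x ≤ descComplexity D' x + c

end KolmogorovLimit

/-! ### Closure properties of oracle computability. -/

section OracleComputability

open Encodable Part

variable {α β γ σ : Type*} [Primcodable α] [Primcodable β] [Primcodable γ] [Primcodable σ]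
variable {O : Set (ℕ →. ℕ)}

namespace RecursiveIn

/-! Upper bound (`exists_limsup_condComplexity_le`): by a limit lemma, a `0'`-computation is the
limit of uniformly computable ones, so a description of `x` under `E` describes `x` given `n` for
all large `n`.

Lower bound (`exists_descComplexity_le_limsup`): if the limsup is `k`, then `x` has a description of
length at most `k` for every large `n`. For each `k`, `0'` enumerates greedily a set `W` that
contains all such `x`: a candidate enters at stage `s` unless, for some `n ≥ s`, `W` together with
the strings described given `n` would exceed `2 ^ (k + 1)` elements. This exception is enumerable,
hence decidable by `0'`. So `W` stays small, and `x` is never refused at a late stage, since it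
already belongs to the described strings (`exists_mem_selected`). Its index in `W` is a description
of `k + 1` bits. -/

protected theorem bind {f : α →. β} {g : α → β →. σ} (hf : RecursiveIn O f)
    (hg : RecursiveIn₂ O g) : RecursiveIn O fun a => (f a).bind (g a) :=
  (Nat.RecursiveIn.comp hg (.pair Nat.Partrec.some.recursiveIn hf)).of_eq fun n => by
    rcases e : decode (α := α) n
    · simp [Seq.seq]
    · simp only [Seq.seq, e, encodek, Part.bind_map, coe_some, bind_some, bind_eq_bind,
        map_eq_map, map_some, decode_prod_val, Nat.unpair_pair, Option.bind_some,
        Option.map_some]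
      exact (Part.map_bind _ _ _).symm

theorem map {f : α →. β} {g : α → β → σ} (hf : RecursiveIn O f) (hg : ComputableIn₂ O g) :
    RecursiveIn O fun a => (f a).map (g a) := by
  simpa [bind_some_eq_map] using RecursiveIn.bind (g := fun a x => Part.some (g a x)) hf hg

theorem comp {f : β →. σ} {g : α → β} (hf : RecursiveIn O f) (hg : ComputableIn O g) :
    RecursiveIn O fun a => f (g a) :=
  (Nat.RecursiveIn.comp hf hg).of_eq fun n => by
    rcases e : decode (α := α) n <;> simp [encodek]

theorem nat_rec {f : α → ℕ} {g : α →. σ} {h : α → ℕ × σ →. σ} (hf : ComputableIn O f)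
    (hg : RecursiveIn O g) (hh : RecursiveIn₂ O h) :
    RecursiveIn O fun a => (f a).rec (g a) fun y IH => IH.bind fun i => h a (y, i) :=
  (Nat.RecursiveIn.comp (.prec hg hh) (.pair Nat.Partrec.some.recursiveIn hf)).of_eq fun n => by
    rcases e : decode (α := α) n with - | a
    · simp [Seq.seq]
    · simp [Seq.seq, e]
      induction f a <;> simp_all [Part.bind_map]

theorem rfind {p : α → ℕ →. Bool} (hp : RecursiveIn₂ O p) :
    RecursiveIn O fun a => Nat.rfind (p a) :=
  (Nat.RecursiveIn.rfind <| RecursiveIn.map hp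
    ((Primrec.dom_bool fun b => cond b 0 1).comp Primrec.snd).to₂.computableIn₂).of_eq
    fun n => by
      rcases e : decode (α := α) n
      · simpa [e] using Nat.rfind_zero_none _ rfl
      · simp [e, map_map, Function.comp_def, map_id']

end RecursiveIn

namespace ComputableIn

theorem comp {f : β → σ} {g : α → β} (hf : ComputableIn O f) (hg : ComputableIn O g) :
    ComputableIn O fun a => f (g a) :=
  RecursiveIn.comp (f := fun b => Part.some (f b)) hf hg

theorem pair {f : α → β} {g : α → γ} (hf : ComputableIn O f) (hg : ComputableIn O g) :
    ComputableIn O fun a => (f a, g a) :=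
  (Nat.RecursiveIn.pair hf hg).of_eq fun n => by
    rcases e : decode (α := α) n <;> simp [Seq.seq]

theorem comp₂ {f : β → γ → σ} {g : α → β} {h : α → γ} (hf : ComputableIn₂ O f)
    (hg : ComputableIn O g) (hh : ComputableIn O h) : ComputableIn O fun a => f (g a) (h a) :=
  ComputableIn.comp hf (hg.pair hh)

theorem nat_rec {f : α → ℕ} {g : α → σ} {h : α → ℕ × σ → σ} (hf : ComputableIn O f)
    (hg : ComputableIn O g) (hh : ComputableIn₂ O h) :
    ComputableIn O fun a =>
      Nat.rec (motive := fun _ => σ) (g a) (fun y IH => h a (y, IH)) (f a) :=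
  (RecursiveIn.nat_rec (h := fun a p => Part.some (h a p)) hf hg hh).of_eq fun a => by
    beta_reduce
    induction f a <;> simp_all

end ComputableIn

end OracleComputability

/-! ### The limit lemma and the upper bound. -/

namespace KolmogorovLimit

open Encodable Filter

/-- `IsLimitOf f G`: every value of `f` is the eventual value of the approximations `G n`. -/
def IsLimitOf {α σ : Type*} (f : α →. σ) (G : ℕ → α →. σ) : Prop :=
  ∀ a x, x ∈ f a → ∀ᶠ n in atTop, x ∈ G n a

theorem haltingOracle_isLimitOf :
    ∃ G : ℕ → ℕ →. ℕ, Partrec₂ G ∧ IsLimitOf haltingOracle G := by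
  classical
  let g : ℕ → ℕ → ℕ := fun n k => bif
    (Nat.Partrec.Code.evaln n (Nat.Partrec.Code.ofNatCode k.unpair.1) k.unpair.2).isSome
    then 1 else 0
  have hg : Primrec₂ g := by
    have h1 : Primrec fun p : ℕ × ℕ => Nat.Partrec.Code.ofNatCode p.2.unpair.1 := by
      rw [← Nat.Partrec.Code.ofNatCode_eq]
      exact (Primrec.ofNat _).comp (Primrec.fst.comp (Primrec.unpair.comp Primrec.snd))
    exact Primrec.cond (Primrec.option_isSome.comp (Nat.Partrec.Code.primrec_evaln.comp
      ((Primrec.fst.pair h1).pair (Primrec.snd.comp (Primrec.unpair.comp Primrec.snd)))))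
      (Primrec.const 1) (Primrec.const 0)
  refine ⟨fun n k => Part.some (g n k), hg.to_comp, fun k x hx => ?_⟩
  rw [haltingOracle, Part.mem_some_iff] at hx
  subst hx
  simp only [Part.mem_some_iff, g]
  by_cases hk : k ∈ haltingSet
  · obtain ⟨y, hy⟩ := Part.dom_iff_mem.1 hk
    obtain ⟨t, ht⟩ := Nat.Partrec.Code.evaln_complete.1 hy
    filter_upwards [eventually_ge_atTop t] with n hn
    have := Nat.Partrec.Code.evaln_mono hn ht
    simp_all
  · refine Eventually.of_forall fun n => ?_
    have : Nat.Partrec.Code.evaln n (Nat.Partrec.Code.ofNatCode k.unpair.1) k.unpair.2 = none := by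
      refine Option.eq_none_iff_forall_not_mem.2 fun y hy => hk ?_
      exact Part.dom_iff_mem.2 ⟨y, Nat.Partrec.Code.evaln_sound hy⟩
    simp [this, hk]

/-- Eventual values of approximations are preserved by minimisation. -/
theorem eventually_mem_rfind {p : ℕ →. Bool} {q : ℕ → ℕ →. Bool} {x : ℕ}
    (hpq : ∀ m b, b ∈ p m → ∀ᶠ n in atTop, b ∈ q n m) (hx : x ∈ Nat.rfind p) :
    ∀ᶠ n in atTop, x ∈ Nat.rfind (q n) := by
  obtain ⟨h1, h2⟩ := Nat.mem_rfind.1 hx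
  have h3 : ∀ᶠ n in atTop, ∀ m ∈ Finset.range x, false ∈ q n m :=
    (eventually_all_finset _).2 fun m hm => hpq _ _ (h2 (Finset.mem_range.1 hm))
  filter_upwards [hpq _ _ h1, h3] with n a b
  exact Nat.mem_rfind.2 ⟨a, fun {m} hm => b m (Finset.mem_range.2 hm)⟩

theorem partrec₂_prec {F H : ℕ → ℕ →. ℕ} (hF : Partrec₂ F) (hH : Partrec₂ H) :
    Partrec₂ fun n p : ℕ => (p.unpair.2.rec (F n p.unpair.1) fun y IH => IH.bind fun i =>
      H n (Nat.pair p.unpair.1 (Nat.pair y i)) : Part ℕ) := by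
  have h1 : Computable fun z : ℕ × ℕ => z.2.unpair.1 :=
    Computable.fst.comp (Computable.unpair.comp Computable.snd)
  have h2 : Computable fun z : ℕ × ℕ => z.2.unpair.2 :=
    Computable.snd.comp (Computable.unpair.comp Computable.snd)
  have h3 : Computable fun z : (ℕ × ℕ) × ℕ × ℕ => Nat.pair z.2.1 z.2.2 :=
    Primrec₂.natPair.to_comp.comp (Computable.fst.comp Computable.snd)
      (Computable.snd.comp Computable.snd)
  have h4 : Computable fun z : (ℕ × ℕ) × ℕ × ℕ => z.1.2.unpair.1 := h1.comp Computable.fst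
  have h5 : Partrec₂ fun (z : ℕ × ℕ) (q : ℕ × ℕ) =>
      H z.1 (Nat.pair z.2.unpair.1 (Nat.pair q.1 q.2)) :=
    Partrec₂.comp hH (Computable.fst.comp Computable.fst) (Primrec₂.natPair.to_comp.comp h4 h3)
  exact Partrec.nat_rec h2 (Partrec₂.comp hF Computable.fst h1) h5

/-- A halting computation uses finitely many intermediate values, each eventually correct. Where `f`
diverges the approximations are unconstrained; spurious values only add descriptions, which is
harmless for an upper bound. -/
theorem _root_.Nat.RecursiveIn.exists_isLimitOf {f : ℕ →. ℕ}
    (hf : Nat.RecursiveIn {haltingOracle} f) :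
    ∃ G : ℕ → ℕ →. ℕ, Partrec₂ G ∧ IsLimitOf f G := by
  have lift : ∀ {f : ℕ →. ℕ}, Nat.Partrec f → ∃ G : ℕ → ℕ →. ℕ, Partrec₂ G ∧ IsLimitOf f G :=
    fun {f} hf => ⟨fun _ => f, (Partrec.nat_iff.2 hf).comp Computable.snd,
      fun a x hx => Eventually.of_forall fun _ => hx⟩
  induction hf with
  | zero => exact lift .zero
  | succ => exact lift .succ
  | left => exact lift .left
  | right => exact lift .right
  | oracle g hg => rw [Set.mem_singleton_iff.1 hg]; exact haltingOracle_isLimitOf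
  | @pair f h _ _ ihf ihh =>
    obtain ⟨F, hF, lF⟩ := ihf
    obtain ⟨H, hH, lH⟩ := ihh
    refine ⟨fun n a => (F n a).bind fun y => (H n a).map fun z => Nat.pair y z, ?_, ?_⟩
    · exact Partrec.bind hF (Partrec.map (Partrec.comp hH Computable.fst)
        (Primrec₂.natPair.comp (Primrec.snd.comp Primrec.fst) Primrec.snd).to_comp)
    · intro a x hx
      simp only [Seq.seq, Part.map_eq_map, Part.mem_bind_iff, Part.mem_map_iff] at hx
      obtain ⟨_, ⟨y, hy, rfl⟩, z, hz, rfl⟩ := hx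
      filter_upwards [lF a y hy, lH a z hz] with n h1 h2
      exact Part.mem_bind_iff.2 ⟨y, h1, Part.mem_map_iff _ |>.2 ⟨z, h2, rfl⟩⟩
  | @comp f h _ _ ihf ihh =>
    obtain ⟨F, hF, lF⟩ := ihf
    obtain ⟨H, hH, lH⟩ := ihh
    refine ⟨fun n a => (H n a).bind (F n), ?_, ?_⟩
    · exact Partrec.bind hH (Partrec.comp hF
        ((Computable.fst.comp Computable.fst).pair Computable.snd))
    · intro a x hx
      obtain ⟨y, hy, hz⟩ := Part.mem_bind_iff.1 hx
      filter_upwards [lH a y hy, lF y x hz] with n h1 h2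
      exact Part.mem_bind_iff.2 ⟨y, h1, h2⟩
  | @prec f h _ _ ihf ihh =>
    obtain ⟨F, hF, lF⟩ := ihf
    obtain ⟨H, hH, lH⟩ := ihh
    refine ⟨fun n p => p.unpair.2.rec (F n p.unpair.1) fun y IH => IH.bind fun i =>
      H n (Nat.pair p.unpair.1 (Nat.pair y i)), ?_, ?_⟩
    · exact partrec₂_prec hF hH
    · intro p x hx
      dsimp only at hx ⊢
      generalize p.unpair.1 = a at hx ⊢
      generalize p.unpair.2 = m at hx ⊢
      induction m generalizing x with
      | zero => exact lF _ _ hx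
      | succ m ih =>
        obtain ⟨i, hi, hx⟩ := Part.mem_bind_iff.1 hx
        filter_upwards [ih i hi, lH _ _ hx] with n h1 h2
        exact Part.mem_bind_iff.2 ⟨i, h1, h2⟩
  | @rfind f _ ihf =>
    obtain ⟨F, hF, lF⟩ := ihf
    refine ⟨fun n a => Nat.rfind fun m => (F n (Nat.pair a m)).map fun y => decide (y = 0), ?_, ?_⟩
    · refine Partrec.rfind (p := fun q : ℕ × ℕ => fun m =>
        (F q.1 (Nat.pair q.2 m)).map fun y => decide (y = 0)) ?_
      refine Partrec.map (Partrec.comp hF ((Computable.fst.comp Computable.fst).pair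
        (Primrec₂.natPair.to_comp.comp (Computable.snd.comp Computable.fst) Computable.snd))) ?_
      exact (PrimrecPred.decide (Primrec.eq.comp Primrec.snd (Primrec.const 0))).to_comp
    · intro a x hx
      refine eventually_mem_rfind (fun m b hb => ?_) hx
      obtain ⟨y, hy, rfl⟩ := (Part.mem_map_iff _).1 hb
      filter_upwards [lF _ y hy] with n h1
      exact (Part.mem_map_iff _).2 ⟨y, h1, rfl⟩

theorem _root_.RecursiveIn.exists_isLimitOf {α σ : Type*} [Primcodable α] [Primcodable σ]
    {f : α →. σ} (hf : RecursiveIn {haltingOracle} f) :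
    ∃ G : ℕ → α →. σ, Partrec₂ G ∧ IsLimitOf f G := by
  obtain ⟨F, hF, lF⟩ := Nat.RecursiveIn.exists_isLimitOf hf
  refine ⟨fun n a => (F n (encode a)).bind fun y => (decode (α := σ) y : Part σ), ?_, ?_⟩
  · exact Partrec.bind (Partrec.comp hF
      (Computable.fst.pair (Computable.encode.comp Computable.snd)))
      (Computable.ofOption (Computable.decode.comp Computable.snd))
  · intro a x hx
    filter_upwards [lF (encode a) (encode x) (by simpa using hx)] with n hn
    exact Part.mem_bind_iff.2 ⟨_, hn, by simp⟩

theorem descComplexity_le_of_mem {D : BinStr →. BinStr} {p x : BinStr} (h : x ∈ D p) :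
    descComplexity D x ≤ p.length :=
  iInf₂_le p h

theorem exists_mem_length_le_of_descComplexity_le {D : BinStr →. BinStr} {x : BinStr} {k : ℕ}
    (h : descComplexity D x ≤ k) : ∃ p, p.length ≤ k ∧ x ∈ D p := by
  by_contra! hc
  have : ((k + 1 : ℕ) : ℕ∞) ≤ descComplexity D x := by
    refine le_iInf₂ fun p hp => ?_
    by_contra! hlt
    exact hc p (Nat.lt_succ_iff.1 (by exact_mod_cast hlt)) hp
  have : k + 1 ≤ k := by exact_mod_cast this.trans h
  omega

theorem exists_limsup_condComplexity_le {D : BinStr → ℕ →. BinStr} (hD : IsOptimalCond D)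
    {E : BinStr →. BinStr} (hE : RecursiveIn {haltingOracle} E) :
    ∃ c : ℕ, ∀ x, limsup (fun n => condComplexity D x n) atTop ≤ descComplexity E x + c := by
  obtain ⟨G, hG, lG⟩ := hE.exists_isLimitOf
  obtain ⟨c, hc⟩ := hD.optimal (fun p n => G n p)
    (Partrec.comp hG (Computable.snd.pair Computable.fst))
  refine ⟨c, fun x => ?_⟩
  rcases eq_or_ne (descComplexity E x) ⊤ with h | h
  · simp [h]
  obtain ⟨k, hk⟩ := ENat.ne_top_iff_exists.1 h
  obtain ⟨p, hp, hx⟩ := exists_mem_length_le_of_descComplexity_le hk.ge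
  refine limsup_le_of_le (by isBoundedDefault) ?_
  filter_upwards [lG p x hx] with n hn
  refine (hc x n).trans (add_le_add_left ?_ _)
  refine (descComplexity_le_of_mem (D := fun p => G n p) hn).trans ?_
  rw [← hk]
  exact_mod_cast hp

end KolmogorovLimit

/-! ### Enumeration by stages and list operations. -/

section Primrec

open Encodable

variable {α σ : Type*} [Primcodable α] [Primcodable σ]

theorem Partrec.exists_stages {f : α →. σ} (hf : Partrec f) :
    ∃ g : ℕ → α → Option σ, Primrec₂ g ∧ (∀ s t a x, s ≤ t → x ∈ g s a → x ∈ g t a) ∧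
      ∀ a x, x ∈ f a ↔ ∃ t, x ∈ g t a := by
  obtain ⟨c, hc⟩ := Nat.Partrec.Code.exists_code.1 hf
  have key : ∀ a y, y ∈ c.eval (encode a) ↔ ∃ x ∈ f a, encode x = y := by
    intro a y
    simp [hc]
  refine ⟨fun t a => (c.evaln t (encode a)).bind decode, ?_, ?_, ?_⟩
  · exact Primrec.option_bind (Nat.Partrec.Code.primrec_evaln.comp
      ((Primrec.fst.pair (Primrec.const c)).pair (Primrec.encode.comp Primrec.snd)))
      (Primrec.decode.comp Primrec.snd)
  · intro s t a x hst hx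
    obtain ⟨y, hy, hx⟩ := Option.mem_bind_iff.1 hx
    exact Option.mem_bind_iff.2 ⟨y, Nat.Partrec.Code.evaln_mono hst hy, hx⟩
  · intro a x
    constructor
    · intro hx
      obtain ⟨t, ht⟩ := Nat.Partrec.Code.evaln_complete.1 ((key a _).2 ⟨x, hx, rfl⟩)
      exact ⟨t, Option.mem_bind_iff.2 ⟨_, ht, by simp⟩⟩
    · rintro ⟨t, ht⟩
      obtain ⟨y, hy, hx⟩ := Option.mem_bind_iff.1 ht
      obtain ⟨z, hz, rfl⟩ := (key a y).1 (Nat.Partrec.Code.evaln_sound hy)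
      have : z = x := by simpa using hx
      exact this ▸ hz

theorem Primrec.list_insert [BEq α] [LawfulBEq α] :
    Primrec₂ fun (a : α) (l : List α) => l.insert a := by
  classical
  have h : PrimrecPred fun p : α × List α => ∃ b ∈ p.2, b = p.1 :=
    PrimrecRel.comp (Primrec.eq.exists_mem_list) Primrec.snd Primrec.fst
  have hmem : PrimrecPred fun p : α × List α => p.1 ∈ p.2 := h.of_eq (by simp)
  refine (Primrec.ite hmem Primrec.snd (Primrec.list_cons.comp Primrec.fst Primrec.snd)).of_eq ?_
  rintro ⟨a, l⟩
  by_cases ha : a ∈ l <;> simp [ha]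

theorem Primrec.list_union [BEq α] [LawfulBEq α] :
    Primrec₂ fun l₁ l₂ : List α => l₁ ∪ l₂ :=
  (Primrec.list_foldr (f := fun p : List α × List α => p.1) (g := fun p => p.2)
    (h := fun _ q => q.2.insert q.1) Primrec.fst Primrec.snd
    (Primrec.list_insert.comp (Primrec.fst.comp Primrec.snd) (Primrec.snd.comp Primrec.snd))).of_eq
    fun _ => rfl

theorem List.length_union_le {α : Type*} [BEq α] [LawfulBEq α] (l₁ l₂ : List α) :
    (l₁ ∪ l₂).length ≤ l₁.length + l₂.length := by
  induction l₁ with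
  | nil => simp
  | cons a l ih =>
    rw [List.cons_union, List.length_insert, List.length_cons]
    split_ifs <;> omega

end Primrec

/-! ### Deciding enumerable predicates with `0'`; coding by strings. -/

namespace KolmogorovLimit

open Encodable Filter

open Classical in
theorem _root_.REPred.computableIn_haltingOracle {α : Type*} [Primcodable α] {P : α → Prop}
    (hP : REPred P) : ComputableIn {haltingOracle} fun a => decide (P a) := by
  obtain ⟨c, hc⟩ := Nat.Partrec.Code.exists_code.1 hP
  have key : ∀ a, Nat.pair (encode c) (encode a) ∈ haltingSet ↔ P a := by
    intro a
    rw [haltingSet, Set.mem_ofPred_eq, Nat.unpair_pair, ← Nat.Partrec.Code.ofNatCode_eq,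
      Denumerable.ofNat_encode, hc]
    simp [Part.bind, Part.assert]
  have h : ComputableIn {haltingOracle} fun a : α => Nat.pair (encode c) (encode a) :=
    (Primrec₂.natPair.comp (Primrec.const _) Primrec.encode).computableIn
  have h1 : ComputableIn₂ {haltingOracle} fun (_ : α) (y : ℕ) => decide (y = 1) :=
    (PrimrecPred.decide (Primrec.eq.comp Primrec.snd (Primrec.const 1))).computableIn
  refine (((RecursiveIn.oracle haltingOracle (Set.mem_singleton _)).comp h).map h1).of_eq fun a => ?_
  by_cases ha : P a <;> simp [haltingOracle, key, ha]

/-- The list of all binary strings of length at most `k`. -/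
def stringsUpTo : ℕ → List BinStr
  | 0 => [[]]
  | k + 1 => [] :: (stringsUpTo k).flatMap fun p => [false :: p, true :: p]

theorem mem_stringsUpTo {k : ℕ} {p : BinStr} : p ∈ stringsUpTo k ↔ p.length ≤ k := by
  induction k generalizing p with
  | zero => simp [stringsUpTo]
  | succ k ih =>
    rcases p with _ | ⟨_ | _, p⟩ <;> simp [stringsUpTo, ih]

theorem length_stringsUpTo (k : ℕ) : (stringsUpTo k).length + 1 = 2 ^ (k + 1) := by
  induction k with
  | zero => simp [stringsUpTo]
  | succ k ih => simp [stringsUpTo, List.length_flatMap]; omega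

theorem primrec_stringsUpTo : Primrec stringsUpTo := by
  have h : Primrec₂ fun (_ : ℕ) (l : List BinStr) =>
      ([] : BinStr) :: l.flatMap fun p => [false :: p, true :: p] := by
    have hb : ∀ b : Bool, Primrec fun p : (ℕ × List BinStr) × BinStr => b :: p.2 :=
      fun b => Primrec.list_cons.comp (Primrec.const b) Primrec.snd
    exact Primrec.list_cons.comp (Primrec.const []) (Primrec.list_flatMap Primrec.snd
      (Primrec.list_cons.comp (hb false) (Primrec.list_cons.comp (hb true) (Primrec.const []))))
  refine (Primrec.nat_rec₁ [[]] h).of_eq fun k => ?_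
  induction k with
  | zero => rfl
  | succ k ih => simp only [stringsUpTo, ← ih]

/-- The number with the given binary expansion, least significant digit first. -/
def binValue (p : BinStr) : ℕ :=
  p.foldr (fun b m => 2 * m + b.toNat) 0

theorem primrec_binValue : Primrec binValue :=
  Primrec.list_foldr (h := fun _ (q : Bool × ℕ) => 2 * q.2 + q.1.toNat) Primrec.id
    (Primrec.const 0) (Primrec.nat_add.comp (Primrec.nat_double.comp
      (Primrec.snd.comp Primrec.snd))
      ((Primrec.dom_bool Bool.toNat).comp (Primrec.fst.comp Primrec.snd)))

/-- Padding with zeros fixes the length exactly, so the length of a code can carry `k` at no extra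
cost. -/
theorem exists_binValue_eq {k i : ℕ} (h : i < 2 ^ k) : ∃ p, p.length = k ∧ binValue p = i := by
  induction k generalizing i with
  | zero => exact ⟨[], rfl, by simp at h; simp [binValue, h]⟩
  | succ k ih =>
    obtain ⟨p, hp, hv⟩ := ih (i := i / 2) (by omega)
    refine ⟨decide (i % 2 = 1) :: p, by simp [hp], ?_⟩
    rw [binValue, List.foldr_cons, ← binValue, hv]
    rcases Nat.mod_two_eq_zero_or_one i with h | h <;> simp [h] <;> omega

/-! ### Greedy selection with oracle `0'`. -/

section Selection

variable (run : ℕ → BinStr × ℕ → Option BinStr)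

/-- The strings that have a description of length at most `k` under the condition `n`, as far as
they are found within `t` steps. -/
def described (k n t : ℕ) : List BinStr :=
  (stringsUpTo k).filterMap fun p => run t (p, n)

/-- Adding the strings in `W` to those with a description of length at most `k` gives too many
strings for some condition `n ≥ s`. -/
def Overflow (k s : ℕ) (W : List BinStr) : Prop :=
  ∃ n t, s ≤ n ∧ 2 ^ (k + 1) < (described run k n t ∪ W).length

/-- A sequence of strings in which each string appears infinitely often. -/
def candidate (s : ℕ) : BinStr :=
  (decode s.unpair.2).getD []

theorem candidate_pair (m : ℕ) (x : BinStr) : candidate (Nat.pair m (encode x)) = x := by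
  simp [candidate]

open Classical in
/-- The strings selected before stage `s`: at each stage the current candidate is added unless
this leads to an overflow. -/
noncomputable def selected (k : ℕ) : ℕ → List BinStr
  | 0 => []
  | s + 1 =>
    if Overflow run k s ((selected k s).insert (candidate s)) then selected k s
    else (selected k s).insert (candidate s)

variable {run}

theorem rePred_overflow (hrun : Primrec₂ run) :
    REPred fun a : (ℕ × ℕ) × List BinStr => Overflow run a.1.1 a.1.2 a.2 := by
  have hdes : Primrec fun z : ℕ × ℕ × ℕ => described run z.1 z.2.1 z.2.2 :=
    Primrec.listFilterMap (primrec_stringsUpTo.comp Primrec.fst)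
      (hrun.comp (Primrec.snd.comp (Primrec.snd.comp Primrec.fst))
        (Primrec.snd.pair (Primrec.fst.comp (Primrec.snd.comp Primrec.fst))))
  have hpow : Primrec fun k : ℕ => 2 ^ (k + 1) :=
    (Primrec₂.unpaired'.1 Nat.Primrec.pow).comp (Primrec.const 2) Primrec.succ
  have hq : PrimrecPred fun z : ((ℕ × ℕ) × List BinStr) × ℕ =>
      2 ^ (z.1.1.1 + 1) <
        (described run z.1.1.1 (z.1.1.2 + z.2.unpair.1) z.2.unpair.2 ∪ z.1.2).length := by
    have hk : Primrec fun z : ((ℕ × ℕ) × List BinStr) × ℕ => z.1.1.1 :=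
      Primrec.fst.comp (Primrec.fst.comp Primrec.fst)
    have hs : Primrec fun z : ((ℕ × ℕ) × List BinStr) × ℕ => z.1.1.2 :=
      Primrec.snd.comp (Primrec.fst.comp Primrec.fst)
    have hu : Primrec fun z : ((ℕ × ℕ) × List BinStr) × ℕ => z.2.unpair :=
      Primrec.unpair.comp Primrec.snd
    have hd : Primrec fun z : ((ℕ × ℕ) × List BinStr) × ℕ =>
        described run z.1.1.1 (z.1.1.2 + z.2.unpair.1) z.2.unpair.2 :=
      hdes.comp (hk.pair ((Primrec.nat_add.comp hs (Primrec.fst.comp hu)).pair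
        (Primrec.snd.comp hu)))
    exact Primrec.nat_lt.comp (hpow.comp hk) (Primrec.list_length.comp
      (Primrec.list_union.comp hd (Primrec.snd.comp Primrec.fst)))
  have hp := Partrec.rfind (p := fun (a : (ℕ × ℕ) × List BinStr) (m : ℕ) =>
    Part.some (decide (2 ^ (a.1.1 + 1) <
        (described run a.1.1 (a.1.2 + m.unpair.1) m.unpair.2 ∪ a.2).length)))
    hq.decide.to_comp
  refine hp.dom_re.of_eq fun a => ?_
  refine Nat.rfind_dom.trans ⟨?_, ?_⟩
  · rintro ⟨m, hm, -⟩
    exact ⟨_, _, Nat.le_add_right _ m.unpair.1, by simpa using hm⟩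
  · rintro ⟨n, t, hn, h⟩
    -- The search runs over pairs (offset of `n` from `s`, time), which builds in `s ≤ n`.
    refine ⟨Nat.pair (n - a.1.2) t, ?_, fun _ => trivial⟩
    simpa [Nat.add_sub_cancel' hn] using h

theorem computableIn_selected (hrun : Primrec₂ run) :
    ComputableIn₂ {haltingOracle} (selected run) := by
  classical
  have hcand : Primrec candidate := Primrec.option_getD.comp
    (Primrec.decode.comp (Primrec.snd.comp Primrec.unpair)) (Primrec.const [])
  have hins : Primrec fun z : (ℕ × ℕ) × ℕ × List BinStr => z.2.2.insert (candidate z.2.1) :=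
    Primrec.list_insert.comp (hcand.comp (Primrec.fst.comp Primrec.snd))
      (Primrec.snd.comp Primrec.snd)
  have hov : ComputableIn {haltingOracle} fun z : (ℕ × ℕ) × ℕ × List BinStr =>
      decide (Overflow run z.1.1 z.2.1 (z.2.2.insert (candidate z.2.1))) :=
    (rePred_overflow hrun).computableIn_haltingOracle.comp
      (g := fun z : (ℕ × ℕ) × ℕ × List BinStr => ((z.1.1, z.2.1), z.2.2.insert (candidate z.2.1)))
      (((Primrec.fst.comp Primrec.fst).pair (Primrec.fst.comp Primrec.snd)).pair hins).computableIn
  have hcond : ComputableIn₂ {haltingOracle} fun (b : Bool) (z : (ℕ × ℕ) × ℕ × List BinStr) =>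
      bif b then z.2.2 else z.2.2.insert (candidate z.2.1) :=
    (Primrec.cond Primrec.fst (Primrec.snd.comp (Primrec.snd.comp Primrec.snd))
      (hins.comp Primrec.snd)).computableIn
  have hstep := ComputableIn.comp₂ hcond hov ComputableIn.id
  refine (ComputableIn.nat_rec (f := fun z : ℕ × ℕ => z.2) (g := fun _ => ([] : List BinStr))
    (h := fun z q => bif decide (Overflow run z.1 q.1 (q.2.insert (candidate q.1))) then q.2
      else q.2.insert (candidate q.1)) ComputableIn.snd (ComputableIn.const _) hstep).of_eq ?_
  rintro ⟨k, s⟩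
  congr 1
  dsimp only
  induction s with
  | zero => rfl
  | succ s ih =>
    simp only [selected, ← ih, Bool.cond_decide]

theorem selected_suffix_succ (k s : ℕ) : selected run k s <:+ selected run k (s + 1) := by
  rw [selected]
  split_ifs
  · exact List.suffix_rfl
  · by_cases h : candidate s ∈ selected run k s
    · rw [List.insert_of_mem h]
    · rw [List.insert_of_not_mem h]
      exact List.suffix_cons _ _

theorem selected_suffix {k s t : ℕ} (h : s ≤ t) : selected run k s <:+ selected run k t := by
  induction h with
  | refl => exact List.suffix_rfl
  | step _ ih => exact ih.trans (selected_suffix_succ _ _)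

theorem nodup_selected (k s : ℕ) : (selected run k s).Nodup := by
  induction s with
  | zero => exact List.nodup_nil
  | succ s ih =>
    rw [selected]
    split_ifs
    · exact ih
    · exact ih.insert

/-- The invariant of the greedy choice; raising `s` only removes conditions `n` from consideration.
-/
theorem not_overflow_selected (k s : ℕ) : ¬ Overflow run k s (selected run k s) := by
  induction s with
  | zero =>
    rintro ⟨n, t, -, h⟩
    -- There are only `2 ^ (k + 1) - 1` candidate descriptions.
    have h1 := List.length_union_le (described run k n t) []
    have h2 : (described run k n t).length ≤ (stringsUpTo k).length :=
      List.length_filterMap_le _ _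
    have h3 := length_stringsUpTo k
    simp only [selected, List.length_nil] at h h1
    omega
  | succ s ih =>
    have mono : ∀ W, ¬ Overflow run k s W → ¬ Overflow run k (s + 1) W :=
      fun W hW ⟨n, t, hn, h⟩ => hW ⟨n, t, by omega, h⟩
    rw [selected]
    split_ifs with h
    · exact mono _ ih
    · exact mono _ h

theorem length_selected_le (k s : ℕ) : (selected run k s).length ≤ 2 ^ (k + 1) := by
  by_contra! h
  refine not_overflow_selected (run := run) k s ⟨s, 0, le_rfl, h.trans_le ?_⟩
  exact ((nodup_selected k s).subperm fun x hx =>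
    List.mem_union_iff.2 (.inr hx)).length_le

/-- At a stage `s ≥ N` whose candidate is `x`, adding `x` cannot overflow: for each `n ≥ s`, `x` is
described given `n` after enough time, so the enlarged union lies in one that the invariant already
bounds. -/
theorem exists_mem_selected
    (hmono : ∀ s t a x, s ≤ t → x ∈ run s a → x ∈ run t a) {k N : ℕ} {x : BinStr}
    (hx : ∀ n ≥ N, ∃ t, x ∈ described run k n t) : ∃ s, x ∈ selected run k s := by
  have dmono : ∀ {n t u}, t ≤ u → described run k n t ⊆ described run k n u := by
    intro n t u h y hy
    obtain ⟨p, hp, hy⟩ := List.mem_filterMap.1 hy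
    exact List.mem_filterMap.2 ⟨p, hp, hmono _ _ _ _ h hy⟩
  set s := Nat.pair N (encode x) with hs
  refine ⟨s + 1, ?_⟩
  have hc : candidate s = x := candidate_pair N x
  have hov : ¬ Overflow run k s ((selected run k s).insert x) := by
    rintro ⟨n, t, hn, h⟩
    obtain ⟨u, hu⟩ := hx n ((Nat.left_le_pair _ _).trans hn)
    refine not_overflow_selected (run := run) k s ⟨n, max t u, hn, h.trans_le ?_⟩
    -- Union with a duplicate-free list is duplicate-free, so inclusion bounds the length.
    refine (List.Nodup.subperm ((nodup_selected k s).insert.union _) fun y hy => ?_).length_le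
    rw [List.mem_union_iff, List.mem_insert_iff] at hy
    rw [List.mem_union_iff]
    rcases hy with hy | rfl | hy
    · exact .inl (dmono (le_max_left _ _) hy)
    · exact .inl (dmono (le_max_right _ _) hu)
    · exact .inr hy
  rw [selected, hc, if_neg hov]
  exact List.mem_insert_self

/-- The description method under which `p` describes the string with number `binValue p` in the
order of selection. -/
noncomputable def selectionMethod (run : ℕ → BinStr × ℕ → Option BinStr) : BinStr →. BinStr :=
  fun p => (Nat.rfind fun s =>
    Part.some (decide (binValue p < (selected run (p.length - 1) s).length))).map fun s =>
      (selected run (p.length - 1) s).reverse.getD (binValue p) []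

theorem recursiveIn_selectionMethod (hrun : Primrec₂ run) :
    RecursiveIn {haltingOracle} (selectionMethod run) := by
  have hsel : ComputableIn {haltingOracle} fun z : BinStr × ℕ =>
      selected run (z.1.length - 1) z.2 :=
    ComputableIn.comp₂ (computableIn_selected hrun)
      (Primrec.nat_sub.comp (Primrec.list_length.comp Primrec.fst)
        (Primrec.const 1)).computableIn ComputableIn.snd
  have hval : ComputableIn {haltingOracle} fun z : BinStr × ℕ => binValue z.1 :=
    (primrec_binValue.comp Primrec.fst).computableIn
  have htest : ComputableIn₂ {haltingOracle} fun (l : List BinStr) (i : ℕ) =>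
      decide (i < l.length) :=
    (Primrec.nat_lt.comp Primrec.snd (Primrec.list_length.comp Primrec.fst)).decide.computableIn
  have hout : ComputableIn₂ {haltingOracle} fun (l : List BinStr) (i : ℕ) =>
      l.reverse.getD i [] :=
    ((Primrec.list_getD []).comp (Primrec.list_reverse.comp Primrec.fst)
      Primrec.snd).computableIn
  exact RecursiveIn.map (RecursiveIn.rfind (ComputableIn.comp₂ htest hsel hval))
    (ComputableIn.comp₂ (f := fun (l : List BinStr) (i : ℕ) => l.reverse.getD i []) hout hsel hval)

/-- The index of `x` fits in `k + 1` bits, and the decoder recovers `k` from the length of the code.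
-/
theorem descComplexity_selectionMethod_le {k s : ℕ} {x : BinStr} (hx : x ∈ selected run k s) :
    descComplexity (selectionMethod run) x ≤ (k + 1 : ℕ) := by
  obtain ⟨i, hi, hxi⟩ := List.getElem_of_mem (List.mem_reverse.2 hx)
  rw [List.length_reverse] at hi
  obtain ⟨p, hp, hv⟩ := exists_binValue_eq (hi.trans_le (length_selected_le k s))
  rw [← hp]
  refine descComplexity_le_of_mem ?_
  have hk : p.length - 1 = k := by omega
  rw [selectionMethod, Part.mem_map_iff, hk, hv]
  obtain ⟨r, hr, hrs⟩ := Nat.rfind_min'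
    (p := fun s => decide (i < (selected run k s).length)) (m := s) (by simpa using hi)
  refine ⟨r, hr, ?_⟩
  have hir : i < (selected run k r).length := by simpa using Nat.rfind_spec hr
  -- New strings enter at the head, so reversed lists grow at the end and the entry at `i` is the
  -- same at stages `r` and `s`.
  have hpre := List.reverse_prefix.2 (selected_suffix (run := run) (k := k) hrs)
  rw [List.getD_eq_getElem _ _ (by simpa using hir), ← hxi]
  exact hpre.getElem _

end Selection

/-! ### The lower bound and the conclusion. -/

theorem exists_descComplexity_le_limsup {D : BinStr → ℕ →. BinStr} (hD : Partrec₂ D)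
    {E : BinStr →. BinStr} (hE : IsOptimalIn {haltingOracle} E) :
    ∃ c : ℕ, ∀ x, descComplexity E x ≤ limsup (fun n => condComplexity D x n) atTop + c := by
  obtain ⟨run, hrun, hmono, hmem⟩ := Partrec.exists_stages hD
  obtain ⟨c, hc⟩ := hE.optimal _ (recursiveIn_selectionMethod hrun)
  refine ⟨c + 1, fun x => ?_⟩
  rcases eq_or_ne (limsup (fun n => condComplexity D x n) atTop) ⊤ with h | h
  · simp [h]
  obtain ⟨k, hk⟩ := ENat.ne_top_iff_exists.1 h
  -- Complexities are integers: being eventually below `k + 1` means being eventually at most `k`.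
  have hlt : limsup (fun n => condComplexity D x n) atTop < ((k + 1 : ℕ) : ℕ∞) := by
    rw [← hk]; exact_mod_cast Nat.lt_succ_self k
  obtain ⟨N, hN⟩ := eventually_atTop.1 (eventually_lt_of_limsup_lt hlt)
  have hdes : ∀ n ≥ N, ∃ t, x ∈ described run k n t := by
    intro n hn
    have hle : condComplexity D x n ≤ k := by
      have := hN n hn
      push_cast at this
      exact Order.le_of_lt_add_one this
    obtain ⟨p, hp, hx⟩ := exists_mem_length_le_of_descComplexity_le hle
    obtain ⟨t, ht⟩ := (hmem (p, n) x).1 hx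
    exact ⟨t, List.mem_filterMap.2 ⟨p, mem_stringsUpTo.2 hp, ht⟩⟩
  obtain ⟨s, hs⟩ := exists_mem_selected hmono hdes
  calc descComplexity E x ≤ descComplexity (selectionMethod run) x + c := hc x
    _ ≤ ((k + 1 : ℕ) : ℕ∞) + c := add_le_add_left (descComplexity_selectionMethod_le hs) _
    _ = k + (c + 1 : ℕ) := by push_cast; ring
    _ = _ := by rw [hk]

end KolmogorovLimit

theorem theorem1
    (D : KolmogorovLimit.BinStr → ℕ →. KolmogorovLimit.BinStr)
    (hD : KolmogorovLimit.IsOptimalCond D)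
    (E : KolmogorovLimit.BinStr →. KolmogorovLimit.BinStr)
    (hE : KolmogorovLimit.IsOptimalIn {KolmogorovLimit.haltingOracle} E) :
    ∃ c : ℕ, ∀ x : KolmogorovLimit.BinStr,
      Filter.limsup (fun n : ℕ => KolmogorovLimit.condComplexity D x n) Filter.atTop
          ≤ KolmogorovLimit.descComplexity E x + c ∧
      KolmogorovLimit.descComplexity E x
          ≤ Filter.limsup (fun n : ℕ => KolmogorovLimit.condComplexity D x n) Filter.atTop + c := by
  obtain ⟨c₁, h₁⟩ := KolmogorovLimit.exists_limsup_condComplexity_le hD hE.recursiveIn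
  obtain ⟨c₂, h₂⟩ := KolmogorovLimit.exists_descComplexity_le_limsup hD.partrec hE
  refine ⟨max c₁ c₂, fun x => ⟨(h₁ x).trans ?_, (h₂ x).trans ?_⟩⟩
  · gcongr; exact le_max_left _ _
  · gcongr; exact le_max_right _ _
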